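/- Let $d \ge 3$ and let $\mathcal C = \{c \in \mathbb F_3^d : \sum_{i=1}^d c_i = 0\}$ be the ternary "all-ones" single parity-check code of length $d$. Index the coordinates of $\mathbb R^{3d}$ by pairs $(i,j)$ with $i \in \{1,\dots,d\}$ and $j \in \mathbb F_3$. Let $\mathsf F_{\mathrm v} : \mathbb F_3^d \to \{0,1\}^{3d}$ be the constant-weight embedding, $\mathsf F_{\mathrm v}(c)_{i,j} = 1$ if $j = c_i$ and $0$ otherwise, and let $\mathcal P = \operatorname{conv}(\mathsf F_{\mathrm v}(\mathcal C)) \subseteq \mathbb R^{3d}$. Let $\Delta_3^d$ be the set of simplex constraints: the $3d$ inequalities $x_{i,j} \ge 0$ (written $-x_{i,j} \le 0$) and the $d$ equations $\sum_{j \in \mathbb F_3} x_{i,j} = 1$. For $j \in \mathbb F_3$ let $[j] \in \{0,1,2\}$ be its integer representative. For $k \in \mathbb F_3$ let $t_k = (t_{k,j})_{j \in \mathbb F_3}$ with $t_{k,j} = [j+k] - [k]$, that is, $t_0 = (0,1,2)$, $t_1 = (0,1,-1)$, $t_2 = (0,-2,-1)$; these are the building blocks for $m = (0,0,0)$. Let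 $\Theta^{m}$ be the set of all inequalities $\theta^T x \le \kappa$ obtained as follows. Choose $k_1,\dots,k_{d-1} \in \mathbb F_3$ arbitrarily. For $i \le d-1$ let $c_i$ be the position of the largest entry of $t_{k_i}$, let $c_d$ be determined by $c = (c_1,\dots,c_d) \in \mathcal C$, and let $k_d$ be such that the smallest entry of $t_{k_d}$ is at position $c_d$. Then $\theta = (t_{k_1} \mid \dots \mid t_{k_d})$ and $\kappa = \theta^T \mathsf F_{\mathrm v}(c) = \sum_{i=1}^d t_{k_i,c_i}$. For $0 \ne h \in \mathbb F_3$ let $\varphi_h(\Theta^m)$ be obtained from $\Theta^m$ by replacing each $\theta^T x \le \kappa$ by $\theta'^T x \le \kappa$ with $\theta'_{i,j} = \theta_{i,hj}$, and put $\Phi(\Theta^m) = \bigcup_{h \ne 0} \varphi_h(\Theta^m)$. Then the system $$\Theta(d) = \Delta_3^d \cup \Phi(\Theta^m) = \Theta^m \cup \varphi_2(\Theta^m) \cup \Delta_3^d$$ is a complete and irredundant description of $\mathcal P$, and $|\Theta(d)| = 2\cdot 3^{d-1} + 4d$. That is: $\mathcal P$ is the set of solutions of $\Theta(d)$; leaving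 out any single equation or inequality of $\Theta(d)$ strictly enlarges the set of solutions; and $\Theta(d)$ is a minimal representation of $\mathcal P$, i.e. the equations in $\Theta(d)$ have linearly independent left-hand sides and define the affine hull of $\mathcal P$, and the inequalities in $\Theta(d)$ are valid for $\mathcal P$ and correspond one-to-one to the facets of $\mathcal P$ by $(\theta^T x \le \kappa) \mapsto \{x \in \mathcal P : \theta^T x = \kappa\}$. -/

import Mathlib

namespace SPC

/-- The space `ℝ^{dp}`, written as `d` blocks of length `p`; the entries of a block are indexed by
`𝔽_p = ZMod p`. -/
abbrev BlockVec (d p : ℕ) : Type := Fin d → ZMod p → ℝ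

/-- The standard scalar product `aᵀ x` on `ℝ^{dp}`. -/
def dot {d p : ℕ} [NeZero p] (a x : BlockVec d p) : ℝ := ∑ i, ∑ j, a i j * x i j

/-! ### The code and its embedded codeword polytope -/

/-- The "all-ones" single parity-check code of length `d` over `𝔽_p`: its parity-check matrix is
the row `(1, …, 1)`. -/
def allOnesCode (d p : ℕ) : Set (Fin d → ZMod p) := {c | ∑ i, c i = 0}

/-- The constant-weight embedding: `ζ ∈ 𝔽_p` goes to the unit vector at position `ζ`, and a word
to the concatenation of the images of its entries. -/
def embed {d p : ℕ} (c : Fin d → ZMod p) : BlockVec d p := fun i j => if j = c i then 1 else 0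

/-- The codeword polytope: the convex hull of the embedded all-ones single parity-check code. -/
def codewordPolytope (d p : ℕ) : Set (BlockVec d p) := convexHull ℝ (embed '' allOnesCode d p)

/-! ### Systems of linear equations and inequalities, and polyhedra -/

/-- A linear constraint on `ℝ^{dp}`: an inequality `aᵀ x ≤ b` or an equation `aᵀ x = b`. -/
inductive LinConstraint (d p : ℕ) : Type
  | le (a : BlockVec d p) (b : ℝ) : LinConstraint d p
  | eq (a : BlockVec d p) (b : ℝ) : LinConstraint d p

/-- `x` satisfies the given constraint. -/
def LinConstraint.Holds {d p : ℕ} [NeZero p] (x : BlockVec d p) : LinConstraint d p → Prop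
  | .le a b => dot a x ≤ b
  | .eq a b => dot a x = b

/-- The set of common solutions of a system of linear constraints. -/
def solutionSet {d p : ℕ} [NeZero p] (S : Set (LinConstraint d p)) : Set (BlockVec d p) :=
  {x | ∀ c ∈ S, c.Holds x}

/-- The system `S` describes the set `P` completely. -/
def IsComplete {d p : ℕ} [NeZero p] (S : Set (LinConstraint d p)) (P : Set (BlockVec d p)) :
    Prop :=
  P = solutionSet S

/-- No member of the system `S` can be left out without changing the set of solutions. -/
def IsIrredundant {d p : ℕ} [NeZero p] (S : Set (LinConstraint d p)) : Prop :=
  ∀ c ∈ S, solutionSet (S \ {c}) ≠ solutionSet S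

/-- The part of `P` on which `aᵀ x ≤ b` is tight, for the pair `ab = (a, b)`. -/
def tightSet {d p : ℕ} [NeZero p] (P : Set (BlockVec d p)) (ab : BlockVec d p × ℝ) :
    Set (BlockVec d p) :=
  {x ∈ P | dot ab.1 x = ab.2}

/-- The dimension of (the affine hull of) a nonempty set. -/
noncomputable def dimension {d p : ℕ} (F : Set (BlockVec d p)) : ℕ :=
  Module.finrank ℝ (vectorSpan ℝ F)

/-- `F` is a facet of `P`: a nonempty face, cut out by some valid inequality, whose dimension is
one less than that of `P`. -/
def IsFacet {d p : ℕ} [NeZero p] (P F : Set (BlockVec d p)) : Prop :=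
  (∃ ab : BlockVec d p × ℝ, (∀ x ∈ P, dot ab.1 x ≤ ab.2) ∧ F = tightSet P ab) ∧
    F.Nonempty ∧ dimension F + 1 = dimension P

/-- The system `S` has the form of a minimal representation of `P`: its equations have linearly
independent left-hand sides and define the affine hull of `P`, its inequalities are valid for `P`,
and they are in one-to-one correspondence with the facets of `P` via the faces they define. -/
def IsMinimalRepresentation {d p : ℕ} [NeZero p] (S : Set (LinConstraint d p))
    (P : Set (BlockVec d p)) : Prop :=
  LinearIndependent ℝ
      (fun ab : {ab : BlockVec d p × ℝ // LinConstraint.eq ab.1 ab.2 ∈ S} => ab.1.1) ∧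
    (affineSpan ℝ P : Set (BlockVec d p)) = {x | ∀ a b, LinConstraint.eq a b ∈ S → dot a x = b} ∧
    (∀ a b, LinConstraint.le a b ∈ S → ∀ x ∈ P, dot a x ≤ b) ∧
    Set.BijOn (tightSet P) {ab | LinConstraint.le ab.1 ab.2 ∈ S} {F | IsFacet P F}

/-! ### The simplex constraints -/

/-- The simplex constraints `Δ_p^d`: the `d * p` inequalities `x_{i,j} ≥ 0`, written as
`-x_{i,j} ≤ 0`, and the `d` equations `∑ j, x_{i,j} = 1`. -/
def simplexConstraints (d p : ℕ) : Set (LinConstraint d p) :=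
  Set.range (fun ij : Fin d × ZMod p =>
      LinConstraint.le (fun i j => if i = ij.1 ∧ j = ij.2 then -1 else 0) 0) ∪
    Set.range (fun i₀ : Fin d => LinConstraint.eq (fun i _ => if i = i₀ then 1 else 0) 1)

/-! ### Inequalities from building blocks -/

/-- The building block `t_0` of the basic class given by `m ∈ {0,1}^p` with `m 0 = 0`:
`t_{0,j} = [j] + m_j p`, where `[j] ∈ {0, …, p - 1}` represents `j`. -/
def baseBlock {p : ℕ} (m : ZMod p → Fin 2) (j : ZMod p) : ℝ :=
  (j.val : ℝ) + ((m j).val : ℝ) * (p : ℝ)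

/-- The building block `t_k`, with entries `t_{k,j} = t_{0,j+k} - t_{0,k}`. For `k = 0` this is
`baseBlock m`, since `t_{0,0} = 0`. -/
def block {p : ℕ} (m : ZMod p → Fin 2) (k j : ZMod p) : ℝ := baseBlock m (j + k) - baseBlock m k

/-- The set `Θ^m` of inequalities `θᵀ x ≤ κ` of the Hi-Lo construction, with
`θ = (t_{k_1} | … | t_{k_d})`. Here `c` is the canonical codeword: in each of the first `d - 1`
positions `c i` is the index of the largest entry of `t_{k_i}`, the last entry of `c` is determined
by `c` being a codeword, and the last block is the one whose smallest entry is at that index;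
`κ` is the value of `θ` at the embedding of `c`. -/
def hiLo (d : ℕ) {p : ℕ} [NeZero p] (m : ZMod p → Fin 2) : Set (LinConstraint d p) :=
  {q | ∃ k c : Fin d → ZMod p, c ∈ allOnesCode d p ∧
    (∀ i : Fin d, (i : ℕ) + 1 < d → ∀ j, block m (k i) j ≤ block m (k i) (c i)) ∧
    (∀ i : Fin d, (i : ℕ) + 1 = d → ∀ j, block m (k i) (c i) ≤ block m (k i) j) ∧
    q = LinConstraint.le (fun i => block m (k i)) (dot (fun i => block m (k i)) (embed c))}

/-- The rotation of `ℝ^{dp}` that permutes each block by `φ_h : ζ ↦ h * ζ`. -/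
def rot {d p : ℕ} (h : ZMod p) (a : BlockVec d p) : BlockVec d p := fun i j => a i (h * j)

/-- Rotation of the left-hand side of a constraint. -/
def LinConstraint.rotate {d p : ℕ} (h : ZMod p) : LinConstraint d p → LinConstraint d p
  | .le a b => .le (rot h a) b
  | .eq a b => .eq (rot h a) b

/-- `φ_h(S)`: all constraints of `S`, with the left-hand side rotated by `φ_h`. -/
def phi {d p : ℕ} (h : ZMod p) (S : Set (LinConstraint d p)) : Set (LinConstraint d p) :=
  LinConstraint.rotate h '' S

/-- `Φ(S)`: the union of all `φ_h(S)` with `h ≠ 0`. -/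
def Phi {d p : ℕ} (S : Set (LinConstraint d p)) : Set (LinConstraint d p) :=
  ⋃ h ∈ {h : ZMod p | h ≠ 0}, phi h S

/-- The system for the ternary code: the simplex constraints together with `Φ(Θ^m)`,
`m = (0,0,0)`. -/
def ternarySystem (d : ℕ) : Set (LinConstraint d 3) :=
  simplexConstraints d 3 ∪ Phi (hiLo d (fun _ : ZMod 3 => 0))

end SPC

/-!
Let `θᵀ x ≤ κ` be the inequality of `Φ(Θ^m)` with rotation `h` and blocks `k_1, …, k_d`. On points
with unit block sums it says that `∑ i j, [-(1 + k_i) - h j] x_{i,j} ≥ 2` (`dot_hiLoLhs`), and the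
condition that the canonical word lies in the code becomes `∑ i, (k_i + 1) = 1` (`hiLo_eq`). So at a
codeword the left-hand side is a nonnegative integer congruent to `2` modulo `3`, which makes the
inequality valid (`two_le_gap_embed`).

*Completeness.* If a solution `x` were outside the polytope, a linear functional `w` would separate
it. Let `c` be a codeword at which `w` is minimal, and put `α_i = w_i(c_i + 1) - w_i(c_i)`,
`β_i = w_i(c_i + 2) - w_i(c_i)`. Moving from `c` to other codewords in two or three positions gives
`α_i + β_j ≥ 0`, `α_i + α_j + α_k ≥ 0` and `β_i + β_j + β_k ≥ 0` for distinct indices. The cone of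
such `(α, β)` is generated by the unit vectors and the inequalities of the system that are tight at
`c`; `sum_nonneg_of_cone` writes down the combination, with the least of all the numbers
`α_i`, `β_i` and the second least among the entries of the same kind deciding which generators
occur. Hence
`w` is at least as large at `x` as at `c`, a contradiction.

*Irredundancy and facets.* The point with all coordinates `1/3` satisfies every inequality strictly,
and for every constraint there is an explicit point violating it and no other
(`exists_violates_nonneg`, `exists_violates_gap`, `exists_violates_equation`). This gives
irredundancy, the distinctness of the constraints and hence their number. By general polyhedral
theory (`affineSpan_of_strict`, `bijOn_tightSet_facets`) it also shows that the equations define the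
affine hull and that the inequalities correspond one-to-one to the facets.
-/

namespace SPC

/-! ### Polyhedra given by an irredundant system -/

section Polyhedron

variable {d p : ℕ} [NeZero p]

/-- The scalar product with `a`, as a linear functional. -/
def dotHom (a : BlockVec d p) : BlockVec d p →ₗ[ℝ] ℝ where
  toFun x := dot a x
  map_add' x y := by simp [dot, mul_add, Finset.sum_add_distrib]
  map_smul' r x := by simp [dot, Finset.mul_sum, mul_left_comm]

@[simp]
lemma dotHom_apply (a x : BlockVec d p) : dotHom a x = dot a x := rfl

lemma dot_add (a x y : BlockVec d p) : dot a (x + y) = dot a x + dot a y := (dotHom a).map_add x y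

lemma dot_sub (a x y : BlockVec d p) : dot a (x - y) = dot a x - dot a y := (dotHom a).map_sub x y

lemma dot_smul (a : BlockVec d p) (r : ℝ) (x : BlockVec d p) : dot a (r • x) = r * dot a x :=
  (dotHom a).map_smul r x

lemma dot_neg (a x : BlockVec d p) : dot a (-x) = -dot a x := (dotHom a).map_neg x

variable {ι κ : Type*} {E : κ → BlockVec d p × ℝ} {A : ι → BlockVec d p × ℝ}
  {P : Set (BlockVec d p)}

/-- `P` is the polyhedron cut out by the equations `E` and the inequalities `A`. -/
def IsCutOutBy (P : Set (BlockVec d p)) (E : κ → BlockVec d p × ℝ) (A : ι → BlockVec d p × ℝ) :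
    Prop :=
  ∀ x, x ∈ P ↔ (∀ k, dot (E k).1 x = (E k).2) ∧ ∀ i, dot (A i).1 x ≤ (A i).2

lemma IsCutOutBy.convex (hP : IsCutOutBy P E A) : Convex ℝ P := by
  have h : P = (⋂ k, {x | dot (E k).1 x = (E k).2}) ∩ ⋂ i, {x | dot (A i).1 x ≤ (A i).2} := by
    ext x
    simpa using hP x
  rw [h]
  exact (convex_iInter fun k => convex_hyperplane (dotHom (E k).1).isLinear _).inter
    (convex_iInter fun i => convex_halfSpace_le (dotHom (A i).1).isLinear _)

/-- The common kernel of the left-hand sides of the equations `E` and of those inequalities in `A`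
whose index lies in `J`. -/
def dirSpace (E : κ → BlockVec d p × ℝ) (A : ι → BlockVec d p × ℝ) (J : Set ι) :
    Submodule ℝ (BlockVec d p) :=
  (⨅ k, LinearMap.ker (dotHom (E k).1)) ⊓ ⨅ i ∈ J, LinearMap.ker (dotHom (A i).1)

lemma mem_dirSpace {J : Set ι} {v : BlockVec d p} :
    v ∈ dirSpace E A J ↔ (∀ k, dot (E k).1 v = 0) ∧ ∀ i ∈ J, dot (A i).1 v = 0 := by
  simp [dirSpace]

/-- From a point of the polyhedron one can move a little in every direction that keeps the
equations and the tight inequalities. -/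
lemma exists_small_step [Finite ι] (hP : IsCutOutBy P E A) {w v : BlockVec d p} (hw : w ∈ P)
    {J : Set ι} (hJ : ∀ i ∉ J, dot (A i).1 w < (A i).2) (hv : v ∈ dirSpace E A J) :
    ∃ ε : ℝ, 0 < ε ∧ w + ε • v ∈ P := by
  rw [mem_dirSpace] at hv
  have hw' := (hP w).1 hw
  have key : ∀ i, ∀ᶠ ε : ℝ in nhdsWithin 0 (Set.Ioi 0),
      dot (A i).1 w + ε * dot (A i).1 v ≤ (A i).2 := by
    intro i
    by_cases hi : i ∈ J
    · exact Filter.Eventually.of_forall fun _ => by simpa [hv.2 i hi] using hw'.2 i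
    · have hc : Filter.Tendsto (fun ε : ℝ => dot (A i).1 w + ε * dot (A i).1 v)
          (nhdsWithin 0 (Set.Ioi 0)) (nhds (dot (A i).1 w + 0 * dot (A i).1 v)) :=
        (Continuous.tendsto (by fun_prop) 0).mono_left nhdsWithin_le_nhds
      exact (hc.eventually (gt_mem_nhds (by simpa using hJ i hi))).mono fun _ h => h.le
  obtain ⟨ε, hε, hpos⟩ := ((Filter.eventually_all.2 key).and self_mem_nhdsWithin).exists
  refine ⟨ε, hpos, (hP _).2 ⟨fun k => ?_, fun i => ?_⟩⟩
  · rw [dot_add, dot_smul, hv.1 k, hw'.1 k, mul_zero, add_zero]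
  · rw [dot_add, dot_smul]
    exact hε i

/-- The direction space of a face, read off from a point in its relative interior. -/
lemma vectorSpan_face [Finite ι] (hP : IsCutOutBy P E A) {w : BlockVec d p} (hw : w ∈ P)
    {J : Set ι} (hJ : ∀ i ∉ J, dot (A i).1 w < (A i).2) (hJ' : ∀ i ∈ J, dot (A i).1 w = (A i).2) :
    vectorSpan ℝ {x ∈ P | ∀ i ∈ J, dot (A i).1 x = (A i).2} = dirSpace E A J := by
  apply le_antisymm
  · rw [vectorSpan, Submodule.span_le]
    rintro _ ⟨x, ⟨hx, hxJ⟩, y, ⟨hy, hyJ⟩, rfl⟩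
    simp only [vsub_eq_sub, SetLike.mem_coe, mem_dirSpace, dot_sub]
    refine ⟨fun k => ?_, fun i hi => ?_⟩
    · rw [((hP x).1 hx).1 k, ((hP y).1 hy).1 k, sub_self]
    · rw [hxJ i hi, hyJ i hi, sub_self]
  · intro v hv
    obtain ⟨ε, hε, hmem⟩ := exists_small_step hP hw hJ hv
    have h : w + ε • v -ᵥ w ∈ vectorSpan ℝ {x ∈ P | ∀ i ∈ J, dot (A i).1 x = (A i).2} := by
      refine vsub_mem_vectorSpan ℝ ⟨hmem, fun i hi => ?_⟩ ⟨hw, hJ'⟩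
      rw [dot_add, dot_smul, (mem_dirSpace.1 hv).2 i hi, hJ' i hi, mul_zero, add_zero]
    rw [vsub_eq_sub, add_sub_cancel_left] at h
    exact (Submodule.smul_mem_iff _ hε.ne').1 h

lemma vectorSpan_of_strict [Finite ι] (hP : IsCutOutBy P E A) {z : BlockVec d p} (hz : z ∈ P)
    (hzs : ∀ i, dot (A i).1 z < (A i).2) : vectorSpan ℝ P = dirSpace E A ∅ := by
  simpa using vectorSpan_face hP hz (J := ∅) (fun i _ => hzs i) (by simp)

lemma vectorSpan_tightSet [Finite ι] (hP : IsCutOutBy P E A) {w : BlockVec d p} (hw : w ∈ P)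
    {q : ι} (hq : dot (A q).1 w = (A q).2) (hs : ∀ i ≠ q, dot (A i).1 w < (A i).2) :
    vectorSpan ℝ (tightSet P (A q)) = dirSpace E A {q} := by
  simpa [tightSet] using vectorSpan_face hP hw (J := {q}) (by simpa using hs) (by simpa using hq)

/-- The equations of a system with a strict solution define the affine hull. -/
lemma affineSpan_of_strict [Finite ι] (hP : IsCutOutBy P E A) {z : BlockVec d p} (hz : z ∈ P)
    (hzs : ∀ i, dot (A i).1 z < (A i).2) :
    (affineSpan ℝ P : Set (BlockVec d p)) = {x | ∀ k, dot (E k).1 x = (E k).2} := by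
  ext x
  have hz' : z ∈ affineSpan ℝ P := subset_affineSpan ℝ P hz
  have h := AffineSubspace.vsub_right_mem_direction_iff_mem hz' x
  rw [direction_affineSpan, vectorSpan_of_strict hP hz hzs, mem_dirSpace] at h
  rw [SetLike.mem_coe, ← h]
  simp [dot_sub, ((hP z).1 hz).1, sub_eq_zero]

/-- A point that is tight for the inequality `q` only, found on the segment from a strict solution
`z` to a point `y` violating `q` alone. -/
lemma exists_tight_only (hP : IsCutOutBy P E A) {z y : BlockVec d p} {q : ι} (hz : z ∈ P)
    (hzs : ∀ i, dot (A i).1 z < (A i).2) (hyE : ∀ k, dot (E k).1 y = (E k).2)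
    (hyq : (A q).2 < dot (A q).1 y) (hy : ∀ i ≠ q, dot (A i).1 y ≤ (A i).2) :
    ∃ w ∈ P, dot (A q).1 w = (A q).2 ∧ ∀ i ≠ q, dot (A i).1 w < (A i).2 := by
  have h1 := hzs q
  set τ : ℝ := ((A q).2 - dot (A q).1 z) / (dot (A q).1 y - dot (A q).1 z) with hτ
  have hden : 0 < dot (A q).1 y - dot (A q).1 z := by linarith
  have hτ0 : 0 < τ := div_pos (by linarith) hden
  have hτ1 : τ < 1 := (div_lt_one hden).2 (by linarith)
  have hval : ∀ a, dot a (z + τ • (y - z)) = (1 - τ) * dot a z + τ * dot a y := by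
    intro a
    rw [dot_add, dot_smul, dot_sub]
    ring
  have hq : dot (A q).1 (z + τ • (y - z)) = (A q).2 := by
    rw [dot_add, dot_smul, dot_sub, hτ, div_mul_cancel₀ _ hden.ne']
    ring
  have hs : ∀ i ≠ q, dot (A i).1 (z + τ • (y - z)) < (A i).2 := by
    intro i hi
    rw [hval]
    nlinarith [hzs i, hy i hi]
  refine ⟨z + τ • (y - z), (hP _).2 ⟨fun k => ?_, fun i => ?_⟩, hq, hs⟩
  · rw [hval, hyE, ((hP z).1 hz).1 k]
    ring
  · rcases eq_or_ne i q with rfl | hi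
    · exact hq.le
    · exact (hs i hi).le

lemma finrank_dirSpace_singleton {q : ι} {v : BlockVec d p} (hv : v ∈ dirSpace E A ∅)
    (hvq : dot (A q).1 v ≠ 0) :
    Module.finrank ℝ (dirSpace E A {q}) + 1 = Module.finrank ℝ (dirSpace E A ∅) := by
  set D := dirSpace E A ∅
  set f : Module.Dual ℝ D := (dotHom (A q).1).domRestrict D
  have hf : f ≠ 0 := fun h => hvq (LinearMap.congr_fun h ⟨v, hv⟩)
  have hmap : dirSpace E A {q} = (LinearMap.ker f).map D.subtype := by
    ext x
    simp [D, f, mem_dirSpace, and_comm]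
  rw [hmap, LinearEquiv.finrank_eq
    (Submodule.equivMapOfInjective D.subtype D.injective_subtype _).symm]
  exact Module.Dual.finrank_ker_add_one_of_ne_zero hf

/-- Finitely many strict inequalities that can be met separately in a convex set can be met
simultaneously there. -/
lemma exists_forall_lt_of_convex {F : Set (BlockVec d p)} (hF : Convex ℝ F) (hne : F.Nonempty)
    (hle : ∀ x ∈ F, ∀ i, dot (A i).1 x ≤ (A i).2) (s : Finset ι)
    (h : ∀ i ∈ s, ∃ x ∈ F, dot (A i).1 x < (A i).2) :
    ∃ x ∈ F, ∀ i ∈ s, dot (A i).1 x < (A i).2 := by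
  classical
  induction s using Finset.induction_on with
  | empty => exact hne.imp fun x hx => ⟨hx, by simp⟩
  | insert a s _ ih =>
    obtain ⟨x, hx, hxs⟩ := ih fun i hi => h i (Finset.mem_insert_of_mem hi)
    obtain ⟨y, hy, hya⟩ := h a (Finset.mem_insert_self a s)
    refine ⟨(1 / 2 : ℝ) • x + (1 / 2 : ℝ) • y,
      hF hx hy (by norm_num) (by norm_num) (by norm_num), fun i hi => ?_⟩
    rw [dot_add, dot_smul, dot_smul]
    rcases Finset.mem_insert.1 hi with rfl | hi
    · linarith [hle x hx i]
    · linarith [hle y hy i, hxs i hi]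

/-- Every facet of a polyhedron is the tight set of one of the defining inequalities, once each of
these has a point in the polyhedron where it alone is tight. -/
lemma IsFacet.exists_eq_tightSet [Finite ι] (hP : IsCutOutBy P E A) {z : BlockVec d p}
    (hz : z ∈ P) (hzs : ∀ i, dot (A i).1 z < (A i).2)
    (hdim : ∀ q, dimension (tightSet P (A q)) + 1 = dimension P)
    {F : Set (BlockVec d p)} (hF : IsFacet P F) : ∃ q, tightSet P (A q) = F := by
  obtain ⟨⟨⟨a, b⟩, hval, rfl⟩, hne, hFd⟩ := hF
  have hconv : Convex ℝ (tightSet P (a, b)) :=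
    hP.convex.inter (convex_hyperplane (dotHom a).isLinear b)
  have hsub : ∃ q, tightSet P (a, b) ⊆ tightSet P (A q) := by
    by_contra! hcon
    cases nonempty_fintype ι
    obtain ⟨x, hx, hxs⟩ := exists_forall_lt_of_convex hconv hne
      (fun x hx i => ((hP x).1 hx.1).2 i) Finset.univ (A := A) (fun q _ => by
        obtain ⟨x, hx, hxq⟩ := Set.not_subset.1 (hcon q)
        exact ⟨x, hx, lt_of_le_of_ne (((hP x).1 hx.1).2 q) fun h => hxq ⟨hx.1, h⟩⟩)
    have hxt : dot a x = b := hx.2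
    -- a functional that is maximal at an interior point of `P` is constant on `P`
    have hle : ∀ v ∈ dirSpace E A ∅, dot a v ≤ 0 := by
      intro v hv
      obtain ⟨ε, hε, hm⟩ := exists_small_step hP hx.1 (J := ∅) (fun i _ => hxs i (by simp)) hv
      have h := hval _ hm
      simp only [dot_add, dot_smul, hxt] at h
      nlinarith
    have hPF : tightSet P (a, b) = P := by
      refine Set.Subset.antisymm (fun y hy => hy.1) fun y hy => ⟨hy, ?_⟩
      have hyx : y - x ∈ dirSpace E A ∅ := by
        rw [← vectorSpan_of_strict hP hz hzs]
        exact vsub_mem_vectorSpan ℝ hy hx.1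
      have h1 := hle _ hyx
      have h2 := hle _ (neg_mem hyx)
      rw [dot_neg, dot_sub, hxt] at h2
      rw [dot_sub, hxt] at h1
      change dot a y = b
      linarith
    rw [hPF] at hFd
    omega
  obtain ⟨q, hq⟩ := hsub
  refine ⟨q, Set.Subset.antisymm (fun y hy => ⟨hy.1, ?_⟩) hq⟩
  have hspan : vectorSpan ℝ (tightSet P (a, b)) = vectorSpan ℝ (tightSet P (A q)) :=
    Submodule.eq_of_le_of_finrank_eq (vectorSpan_mono ℝ hq) (by
      have := hdim q
      unfold dimension at this hFd
      omega)
  obtain ⟨x, hx⟩ := hne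
  have hxt : dot a x = b := hx.2
  have hker : vectorSpan ℝ (tightSet P (a, b)) ≤ LinearMap.ker (dotHom a) := by
    rw [vectorSpan, Submodule.span_le]
    rintro _ ⟨x, ⟨_, hx⟩, y, ⟨_, hy⟩, rfl⟩
    change dot a (x - y) = 0
    rw [dot_sub, sub_eq_zero]
    exact hx.trans hy.symm
  have hyx : dot a (y - x) = 0 :=
    hker (hspan ▸ vsub_mem_vectorSpan ℝ hy (hq hx) : y - x ∈ vectorSpan ℝ (tightSet P (a, b)))
  rw [dot_sub, hxt, sub_eq_zero] at hyx
  exact hyx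

/-- If the system has a strict solution and each inequality is violated by a point that satisfies
all the others, then the inequalities correspond one-to-one to the facets. -/
theorem bijOn_tightSet_facets [Finite ι] (hP : IsCutOutBy P E A) {z : BlockVec d p} (hz : z ∈ P)
    (hzs : ∀ i, dot (A i).1 z < (A i).2)
    (hy : ∀ q, ∃ y, (∀ k, dot (E k).1 y = (E k).2) ∧ (A q).2 < dot (A q).1 y ∧
      ∀ i ≠ q, dot (A i).1 y ≤ (A i).2) :
    Set.BijOn (tightSet P) (Set.range A) {F | IsFacet P F} := by
  have hw : ∀ q, ∃ w ∈ P, dot (A q).1 w = (A q).2 ∧ ∀ i ≠ q, dot (A i).1 w < (A i).2 := by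
    intro q
    obtain ⟨y, hyE, hyq, hy⟩ := hy q
    exact exists_tight_only hP hz hzs hyE hyq hy
  have hdim : ∀ q, dimension (tightSet P (A q)) + 1 = dimension P := by
    intro q
    obtain ⟨w, hwP, hwq, hws⟩ := hw q
    unfold dimension
    rw [vectorSpan_tightSet hP hwP hwq hws, vectorSpan_of_strict hP hz hzs]
    refine finrank_dirSpace_singleton (v := w - z) ?_ ?_
    · rw [← vectorSpan_of_strict hP hz hzs]
      exact vsub_mem_vectorSpan ℝ hwP hz
    · rw [dot_sub, hwq]
      exact (sub_pos.2 (hzs q)).ne'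
  refine ⟨?_, ?_, ?_⟩
  · rintro _ ⟨q, rfl⟩
    obtain ⟨w, hwP, hwq, -⟩ := hw q
    exact ⟨⟨A q, fun x hx => ((hP x).1 hx).2 q, rfl⟩, ⟨w, hwP, hwq⟩, hdim q⟩
  · rintro _ ⟨q, rfl⟩ _ ⟨q', rfl⟩ h
    obtain ⟨w, hwP, hwq, hws⟩ := hw q
    by_contra hne
    have hmem : w ∈ tightSet P (A q') := (show tightSet P (A q) = tightSet P (A q') from h) ▸
      (⟨hwP, hwq⟩ : w ∈ tightSet P (A q))
    exact (hws q' (fun e => hne (by rw [e]))).ne hmem.2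
  · intro F hF
    obtain ⟨q, hq⟩ := IsFacet.exists_eq_tightSet hP hz hzs hdim hF
    exact ⟨A q, ⟨q, rfl⟩, hq⟩

end Polyhedron

/-! ### The cone of functionals that are minimal at the zero codeword -/

/-- One half of `sum_nonneg_of_cone`: the case where the least of all the numbers `α k`, `β k` is
`α i`. The hypotheses on `α`, `β` say that the functional is nonnegative at the codewords
with entries `1, 2` or `1, 1, 1` off zero. -/
lemma sum_nonneg_of_cone_aux {ι : Type*} [Fintype ι] [DecidableEq ι] {α β u v : ι → ℝ}
    (hu : ∀ i, 0 ≤ u i) (hv : ∀ i, 0 ≤ v i)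
    (hA : ∀ i, 3 * (u i + v i) ≤ ∑ k, (2 * u k + v k))
    (hB : ∀ i j, i ≠ j → 3 * (u i + u j) ≤ ∑ k, (2 * u k + v k))
    (hA' : ∀ i, 3 * (u i + v i) ≤ ∑ k, (u k + 2 * v k))
    (hαβ : ∀ i j, i ≠ j → 0 ≤ α i + β j)
    (hα : ∀ i j k, i ≠ j → i ≠ k → j ≠ k → 0 ≤ α i + α j + α k)
    (i : ι) (hne : ∃ j, j ≠ i) (hmα : ∀ k, α i ≤ α k) (hmβ : ∀ k, α i ≤ β k) :
    0 ≤ ∑ k, (α k * u k + β k * v k) := by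
  rcases le_or_gt 0 (α i) with h0 | h0
  · exact Finset.sum_nonneg fun k _ => add_nonneg
      (mul_nonneg (h0.trans (hmα k)) (hu k)) (mul_nonneg (h0.trans (hmβ k)) (hv k))
  -- `j` carries the second smallest entry of `α`
  obtain ⟨j, hji, hj⟩ : ∃ j, j ≠ i ∧ ∀ k, k ≠ i → α j ≤ α k := by
    obtain ⟨j, hj, hmin⟩ := Finset.exists_min_image (Finset.univ.filter (· ≠ i)) α
      (by obtain ⟨j, hj⟩ := hne; exact ⟨j, by simpa using hj⟩)
    exact ⟨j, by simpa using hj, fun k hk => hmin k (by simpa using hk)⟩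
  have hβk : ∀ k, k ≠ i → -α i ≤ β k := fun k hk => by linarith [hαβ i k hk.symm]
  -- It suffices to bound the sum from below, termwise, by `p` times `hA' i` plus `q` times `hB i j`
  -- plus `r` times `hA i`.
  have main : ∀ p q r : ℝ, 0 ≤ p → 0 ≤ q → 0 ≤ r →
      (∀ k, p * (u k + 2 * v k) + q * (2 * u k + v k) + r * (2 * u k + v k)
        - (if k = i then 3 * p * (u k + v k) + 3 * q * u k + 3 * r * (u k + v k) else 0)
        - (if k = j then 3 * q * u k else 0) ≤ α k * u k + β k * v k) →
      0 ≤ ∑ k, (α k * u k + β k * v k) := by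
    intro p q r hp hq hr h
    have hs := Finset.sum_le_sum fun k (_ : k ∈ Finset.univ) => h k
    simp only [Finset.sum_sub_distrib, Finset.sum_add_distrib (f := fun k => _ * _ + _ * _),
      Finset.sum_add_distrib (f := fun k => p * (u k + 2 * v k)), ← Finset.mul_sum,
      Finset.sum_ite_eq', Finset.mem_univ, if_true] at hs
    refine le_trans ?_ hs
    have h1 := mul_le_mul_of_nonneg_left (hA' i) hp
    have h2 := mul_le_mul_of_nonneg_left (hB i j hji.symm) hq
    have h3 := mul_le_mul_of_nonneg_left (hA i) hr
    linarith
  -- a termwise inequality follows from the inequalities between the coefficients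
  have lin : ∀ (k : ι) {a b a' b' : ℝ}, a ≤ a' → b ≤ b' →
      a * u k + b * v k ≤ a' * u k + b' * v k := fun k _ _ _ _ ha hb =>
    add_le_add (mul_le_mul_of_nonneg_right ha (hu k)) (mul_le_mul_of_nonneg_right hb (hv k))
  -- In each case the coefficients are chosen to give the exact value `α i`, and the exact value
  -- `α j` (first case) or `β i` (last case). Where `p = -α i / 2` alone is used, there is slack.
  rcases le_or_gt (2 * α j) (-α i) with hc | hc
  · refine main ((-α i + α j) / 3) ((-α i - 2 * α j) / 3) 0 (by linarith [hmα j]) (by linarith)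
      le_rfl fun k => ?_
    by_cases hki : k = i
    · subst hki
      rw [if_pos rfl, if_neg hji.symm]
      refine le_trans (le_of_eq ?_) (lin k (le_refl (α k))
        (show -α j ≤ β k by linarith [hαβ j k hji]))
      ring
    · rw [if_neg hki]
      by_cases hkj : k = j
      · subst hkj
        rw [if_pos rfl]
        refine le_trans (le_of_eq ?_) (lin k (le_refl (α k)) (hβk k hki))
        ring
      · rw [if_neg hkj]
        refine le_trans (le_of_eq ?_) (lin k (show -α i - α j ≤ α k by
          linarith [hα i j k hji.symm (Ne.symm hki) (Ne.symm hkj)]) (hβk k hki))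
        ring
  · rcases le_or_gt (-β i) (-α i / 2) with ht | ht
    · refine main (-α i / 2) 0 0 (by linarith) le_rfl le_rfl fun k => ?_
      by_cases hki : k = i
      · subst hki
        rw [if_pos rfl]
        refine le_trans (le_of_eq ?_) (lin k (le_refl (α k)) (show α k / 2 ≤ β k by linarith))
        simp
        ring
      · rw [if_neg hki]
        refine le_trans (le_of_eq ?_) (lin k (show -α i / 2 ≤ α k by linarith [hj k hki])
          (hβk k hki))
        simp
        ring
    · refine main ((-2 * α i + β i) / 3) 0 ((-2 * β i + α i) / 3) (by linarith [hmβ i]) le_rfl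
        (by linarith) fun k => ?_
      by_cases hki : k = i
      · subst hki
        rw [if_pos rfl]
        refine le_of_eq ?_
        simp
        ring
      · rw [if_neg hki]
        refine le_trans (le_of_eq ?_) (lin k (show -β i ≤ α k by linarith [hαβ k i hki])
          (hβk k hki))
        simp
        ring

/-- The cone of all functionals `(α, β)` that are nonnegative at the codewords is generated by the
unit vectors and the functionals of the inequalities `hA`, `hB`, `hA'`, `hB'`. -/
lemma sum_nonneg_of_cone {ι : Type*} [Fintype ι] [DecidableEq ι] [Nontrivial ι]
    {α β u v : ι → ℝ} (hu : ∀ i, 0 ≤ u i) (hv : ∀ i, 0 ≤ v i)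
    (hA : ∀ i, 3 * (u i + v i) ≤ ∑ k, (2 * u k + v k))
    (hB : ∀ i j, i ≠ j → 3 * (u i + u j) ≤ ∑ k, (2 * u k + v k))
    (hA' : ∀ i, 3 * (u i + v i) ≤ ∑ k, (u k + 2 * v k))
    (hB' : ∀ i j, i ≠ j → 3 * (v i + v j) ≤ ∑ k, (u k + 2 * v k))
    (hαβ : ∀ i j, i ≠ j → 0 ≤ α i + β j)
    (hα : ∀ i j k, i ≠ j → i ≠ k → j ≠ k → 0 ≤ α i + α j + α k)
    (hβ : ∀ i j k, i ≠ j → i ≠ k → j ≠ k → 0 ≤ β i + β j + β k) :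
    0 ≤ ∑ k, (α k * u k + β k * v k) := by
  obtain ⟨i, hi⟩ := Finite.exists_min α
  obtain ⟨i', hi'⟩ := Finite.exists_min β
  rcases le_total (α i) (β i') with h | h
  · exact sum_nonneg_of_cone_aux hu hv hA hB hA' hαβ hα i (exists_ne i) hi
      fun k => h.trans (hi' k)
  · have := sum_nonneg_of_cone_aux (α := β) (β := α) hv hu
      (by simpa only [add_comm] using hA') (by simpa only [add_comm] using hB')
      (by simpa only [add_comm] using hA)
      (fun i j hij => by rw [add_comm]; exact hαβ j i hij.symm) hβ i' (exists_ne i') hi'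
      fun k => h.trans (hi k)
    simpa only [add_comm] using this

/-! ### The inequalities of the ternary system in normal form -/

lemma sum_zmod_three (f : ZMod 3 → ℝ) : ∑ j, f j = f 0 + f 1 + f 2 := Fin.sum_univ_three f

lemma val_zmod_three : (0 : ZMod 3).val = 0 ∧ (1 : ZMod 3).val = 1 ∧ (2 : ZMod 3).val = 2 := by
  decide

lemma sum_comp_affine {h : ZMod 3} (hh : h ≠ 0) (e : ZMod 3) (f : ZMod 3 → ℝ) :
    ∑ j, f (e - h * j) = ∑ r, f r := by
  have hb : ∀ h e : ZMod 3, h ≠ 0 → Function.Bijective fun j => e - h * j := by decide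
  exact (hb h e hh).sum_comp f

lemma sum_val_affine {h : ZMod 3} (hh : h ≠ 0) (e : ZMod 3) :
    ∑ j : ZMod 3, ((e - h * j).val : ℝ) = 3 := by
  rw [sum_comp_affine hh e fun r => (r.val : ℝ), sum_zmod_three, val_zmod_three.1,
    val_zmod_three.2.1, val_zmod_three.2.2]
  norm_num

lemma block_zero (k j : ZMod 3) :
    block (fun _ : ZMod 3 => 0) k j = ((j + k).val : ℝ) - (k.val : ℝ) := by
  simp [block, baseBlock]

/-- Reversing the representatives `0, 1, 2`. -/
lemma val_eq_two_sub (m : ZMod 3) : (m.val : ℝ) = 2 - ((-1 - m).val : ℝ) := by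
  have h : ∀ m : ZMod 3, m.val + (-1 - m).val = 2 := by decide
  have := h m
  rw [eq_sub_iff_add_eq]
  exact_mod_cast this

variable {d : ℕ}

/-- The left-hand side `(t_{k_1} | … | t_{k_d})`, rotated by `h`. -/
def hiLoLhs (h : ZMod 3) (k : Fin d → ZMod 3) : BlockVec d 3 :=
  rot h fun i => block (fun _ : ZMod 3 => 0) (k i)

/-- The right-hand side belonging to `hiLoLhs h k`. -/
def hiLoRhs (k : Fin d → ZMod 3) : ℝ := 2 * ((d : ℝ) - 1) - ∑ i, ((k i).val : ℝ)

/-- The weighted sum that the inequality with parameters `h`, `k` bounds from below by `2`. At an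
embedded word `c` it is a sum of the representatives of `-(1 + k i) - h * c i`. -/
def gap (h : ZMod 3) (k : Fin d → ZMod 3) (x : BlockVec d 3) : ℝ :=
  ∑ i, ∑ j, ((-(1 + k i) - h * j).val : ℝ) * x i j

lemma dot_hiLoLhs (h : ZMod 3) (k : Fin d → ZMod 3) {x : BlockVec d 3}
    (hx : ∀ i, ∑ j, x i j = 1) : dot (hiLoLhs h k) x = hiLoRhs k + 2 - gap h k x := by
  have hi : ∀ i, ∑ j, hiLoLhs h k i j * x i j =
      2 - ((k i).val : ℝ) - ∑ j, ((-(1 + k i) - h * j).val : ℝ) * x i j := by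
    intro i
    have hj : ∀ j, hiLoLhs h k i j * x i j =
        (2 - ((k i).val : ℝ)) * x i j - ((-(1 + k i) - h * j).val : ℝ) * x i j := by
      intro j
      rw [hiLoLhs, rot, block_zero, val_eq_two_sub (h * j + k i),
        show -1 - (h * j + k i) = -(1 + k i) - h * j by ring]
      ring
    rw [Finset.sum_congr rfl fun j _ => hj j, Finset.sum_sub_distrib, ← Finset.mul_sum, hx,
      mul_one]
  rw [dot, Finset.sum_congr rfl fun i _ => hi i, Finset.sum_sub_distrib, Finset.sum_sub_distrib,
    gap, hiLoRhs]
  simp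
  ring

lemma dot_embed {p : ℕ} [NeZero p] (w : BlockVec d p) (c : Fin d → ZMod p) :
    dot w (embed c) = ∑ i, w i (c i) := by
  simp [dot, embed]

lemma sum_embed {p : ℕ} [NeZero p] (c : Fin d → ZMod p) (i : Fin d) :
    ∑ j, (embed c : BlockVec d p) i j = 1 := by
  simp [embed]

lemma block_le_max_iff (k c : ZMod 3) :
    (∀ j, block (fun _ : ZMod 3 => 0) k j ≤ block (fun _ : ZMod 3 => 0) k c) ↔ c = -1 - k := by
  have h : ∀ k c : ZMod 3, (∀ j : ZMod 3, (j + k).val ≤ (c + k).val) ↔ c = -1 - k := by decide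
  simpa only [block_zero, sub_le_sub_iff_right, Nat.cast_le] using h k c

lemma block_min_le_iff (k c : ZMod 3) :
    (∀ j, block (fun _ : ZMod 3 => 0) k c ≤ block (fun _ : ZMod 3 => 0) k j) ↔ c = -k := by
  have h : ∀ k c : ZMod 3, (∀ j : ZMod 3, (c + k).val ≤ (j + k).val) ↔ c = -k := by decide
  simpa only [block_zero, sub_le_sub_iff_right, Nat.cast_le] using h k c

/-- The canonical codeword is determined by `k`, and being a codeword is one linear condition on
`k`, in which the last position is not distinguished any more. -/
lemma hiLo_eq (hd : 1 ≤ d) : hiLo d (fun _ : ZMod 3 => 0) =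
    {q | ∃ k : Fin d → ZMod 3, ∑ i, (k i + 1) = 1 ∧
      q = LinConstraint.le (fun i => block (fun _ : ZMod 3 => 0) (k i)) (hiLoRhs k)} := by
  obtain ⟨n, rfl⟩ : ∃ n, d = n + 1 := ⟨d - 1, by omega⟩
  have hsum : ∀ k : Fin (n + 1) → ZMod 3,
      (∑ i : Fin n, (-1 - k i.castSucc) + -k (Fin.last n) = 0 ↔ ∑ i, (k i + 1) = 1) := by
    intro k
    have h : ∑ i : Fin n, (-1 - k i.castSucc) = -∑ i : Fin n, (k i.castSucc + 1) := by
      rw [← Finset.sum_neg_distrib]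
      exact Finset.sum_congr rfl fun i _ => by ring
    rw [Fin.sum_univ_castSucc, h]
    constructor
    · intro h
      linear_combination -h
    · intro h
      linear_combination -h
  have hrhs : ∀ k c : Fin (n + 1) → ZMod 3, (∀ i : Fin n, c i.castSucc = -1 - k i.castSucc) →
      c (Fin.last n) = -k (Fin.last n) →
      dot (fun i => block (fun _ : ZMod 3 => 0) (k i)) (embed c) = hiLoRhs k := by
    intro k c h1 h2
    have h3 : ∀ i : Fin n, block (fun _ : ZMod 3 => 0) (k i.castSucc) (c i.castSucc) =
        2 - ((k i.castSucc).val : ℝ) := by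
      intro i
      rw [block_zero, h1 i, sub_add_cancel]
      simp [show (-1 : ZMod 3).val = 2 by decide]
    rw [dot_embed, Fin.sum_univ_castSucc, Finset.sum_congr rfl fun i _ => h3 i, block_zero, h2,
      hiLoRhs, Fin.sum_univ_castSucc, neg_add_cancel, val_zmod_three.1, Finset.sum_sub_distrib]
    simp
    ring
  ext q
  constructor
  · rintro ⟨k, c, hc, hmax, hmin, rfl⟩
    have h1 : ∀ i : Fin n, c i.castSucc = -1 - k i.castSucc := fun i =>
      (block_le_max_iff _ _).1 (hmax i.castSucc (by simp))
    have h2 : c (Fin.last n) = -k (Fin.last n) :=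
      (block_min_le_iff _ _).1 (hmin (Fin.last n) (by simp))
    refine ⟨k, (hsum k).1 ?_, by rw [hrhs k c h1 h2]⟩
    rw [allOnesCode, Set.mem_ofPred_eq, Fin.sum_univ_castSucc, h2,
      Finset.sum_congr rfl fun i _ => h1 i] at hc
    exact hc
  · rintro ⟨k, hk, rfl⟩
    set c : Fin (n + 1) → ZMod 3 :=
      Fin.snoc (α := fun _ => ZMod 3) (fun i : Fin n => -1 - k i.castSucc) (-k (Fin.last n))
      with hc
    have h1 : ∀ i : Fin n, c i.castSucc = -1 - k i.castSucc := fun i => by simp [hc]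
    have h2 : c (Fin.last n) = -k (Fin.last n) := by simp [hc]
    refine ⟨k, c, ?_, fun i hi => ?_, fun i hi => ?_, by rw [hrhs k c h1 h2]⟩
    · rw [allOnesCode, Set.mem_ofPred_eq, Fin.sum_univ_castSucc, h2,
        Finset.sum_congr rfl fun i _ => h1 i]
      exact (hsum k).2 hk
    · obtain ⟨j, rfl⟩ : ∃ j : Fin n, i = j.castSucc := ⟨⟨i, by omega⟩, rfl⟩
      exact (block_le_max_iff _ _).2 (h1 j)
    · obtain rfl : i = Fin.last n := Fin.ext (by simpa using hi)
      exact (block_min_le_iff _ _).2 h2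

/-- The parameters of the inequalities in `Φ(Θ^m)`: the rotation and the blocks. -/
abbrev HiLoIndex (d : ℕ) : Type :=
  {h : ZMod 3 // h ≠ 0} × {k : Fin d → ZMod 3 // ∑ i, (k i + 1) = 1}

/-- The left-hand and right-hand sides of the inequalities of the ternary system. -/
def ineq (d : ℕ) : (Fin d × ZMod 3) ⊕ HiLoIndex d → BlockVec d 3 × ℝ
  | .inl ij => (fun i j => if i = ij.1 ∧ j = ij.2 then -1 else 0, 0)
  | .inr q => (hiLoLhs q.1 q.2, hiLoRhs q.2.1)

/-- The left-hand and right-hand sides of the equations of the ternary system. -/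
def equation (d : ℕ) (i₀ : Fin d) : BlockVec d 3 × ℝ := (fun i _ => if i = i₀ then 1 else 0, 1)

lemma ternarySystem_eq_range (hd : 1 ≤ d) : ternarySystem d =
    Set.range (fun q => LinConstraint.le (ineq d q).1 (ineq d q).2) ∪
      Set.range (fun i => LinConstraint.eq (equation d i).1 (equation d i).2) := by
  ext c
  simp only [ternarySystem, simplexConstraints, Phi, phi, hiLo_eq hd, Set.mem_union,
    Set.mem_range, Set.mem_iUnion, Set.mem_image, Set.mem_ofPred_eq, Sum.exists]
  constructor
  · rintro ((⟨ij, rfl⟩ | ⟨i, rfl⟩) | ⟨h, hh, _, ⟨k, hk, rfl⟩, rfl⟩)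
    · exact Or.inl (Or.inl ⟨ij, rfl⟩)
    · exact Or.inr ⟨i, rfl⟩
    · exact Or.inl (Or.inr ⟨(⟨h, hh⟩, ⟨k, hk⟩), rfl⟩)
  · rintro ((⟨ij, rfl⟩ | ⟨⟨⟨h, hh⟩, k, hk⟩, rfl⟩) | ⟨i, rfl⟩)
    · exact Or.inl (Or.inl ⟨ij, rfl⟩)
    · exact Or.inr ⟨h, hh, _, ⟨k, hk, rfl⟩, rfl⟩
    · exact Or.inl (Or.inr ⟨i, rfl⟩)

lemma le_mem_ternarySystem (hd : 1 ≤ d) {ab : BlockVec d 3 × ℝ} :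
    LinConstraint.le ab.1 ab.2 ∈ ternarySystem d ↔ ab ∈ Set.range (ineq d) := by
  simp [ternarySystem_eq_range hd, Prod.ext_iff]

lemma eq_mem_ternarySystem (hd : 1 ≤ d) {ab : BlockVec d 3 × ℝ} :
    LinConstraint.eq ab.1 ab.2 ∈ ternarySystem d ↔ ab ∈ Set.range (equation d) := by
  simp [ternarySystem_eq_range hd, Prod.ext_iff]

lemma phi_one {p : ℕ} (S : Set (LinConstraint d p)) : phi 1 S = S := by
  have hrot : ∀ a : BlockVec d p, rot 1 a = a := fun a => by
    funext i j
    rw [rot, one_mul]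
  have h : (LinConstraint.rotate 1 : LinConstraint d p → LinConstraint d p) = id := by
    funext q
    cases q <;> simp [LinConstraint.rotate, hrot]
  rw [phi, h, Set.image_id]

lemma Phi_three (S : Set (LinConstraint d 3)) : Phi S = S ∪ phi 2 S := by
  have h : {h : ZMod 3 | h ≠ 0} = {1, 2} := by
    ext h
    revert h
    decide
  rw [Phi, h, Set.biUnion_pair, phi_one]

lemma dot_equation (i₀ : Fin d) (x : BlockVec d 3) : dot (equation d i₀).1 x = ∑ j, x i₀ j := by
  simp [dot, equation, ite_mul, Finset.sum_ite_irrel]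

lemma dot_ineq_inl (ij : Fin d × ZMod 3) (x : BlockVec d 3) :
    dot (ineq d (.inl ij)).1 x = -x ij.1 ij.2 := by
  simp [dot, ineq, ite_and, ite_mul, Finset.sum_ite_irrel]

/-- The solutions of the ternary system, described without building blocks. -/
lemma holds_iff {x : BlockVec d 3} :
    ((∀ i, dot (equation d i).1 x = (equation d i).2) ∧ ∀ q, dot (ineq d q).1 x ≤ (ineq d q).2) ↔
      (∀ i, ∑ j, x i j = 1) ∧ (∀ i j, 0 ≤ x i j) ∧ ∀ q : HiLoIndex d, 2 ≤ gap q.1 q.2 x := by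
  have he : (∀ i, dot (equation d i).1 x = (equation d i).2) ↔ ∀ i, ∑ j, x i j = 1 :=
    forall_congr' fun i => by rw [dot_equation]; rfl
  rw [he]
  refine and_congr_right fun hx => ?_
  simp only [Sum.forall, dot_ineq_inl]
  refine and_congr ?_ (forall_congr' fun q => ?_)
  · simp [ineq]
  · change dot (hiLoLhs q.1 q.2) x ≤ hiLoRhs q.2.1 ↔ _
    rw [dot_hiLoLhs _ _ hx]
    constructor <;> intro h <;> linarith

/-! ### Completeness -/

/-- The inequalities hold at the codewords: the weighted sum is a nonnegative integer congruent to
`2` modulo `3`. -/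
lemma two_le_gap_embed {h : ZMod 3} {k c : Fin d → ZMod 3} (hk : ∑ i, (k i + 1) = 1)
    (hc : c ∈ allOnesCode d 3) : 2 ≤ gap h k (embed c) := by
  have hc' : ∑ i, c i = 0 := hc
  have hg : gap h k (embed c) = ((∑ i, (-(1 + k i) - h * c i).val : ℕ) : ℝ) := by
    simp [gap, embed]
  have hmod : ((∑ i, (-(1 + k i) - h * c i).val : ℕ) : ZMod 3) = -1 := by
    rw [Nat.cast_sum]
    simp only [ZMod.natCast_val, ZMod.cast_id', id_eq]
    rw [Finset.sum_sub_distrib, ← Finset.mul_sum, hc', Finset.sum_neg_distrib,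
      Finset.sum_congr rfl fun i _ => add_comm 1 (k i), hk, mul_zero, sub_zero]
  rw [hg]
  have h2 : 2 ≤ ∑ i, (-(1 + k i) - h * c i).val := by
    by_contra! hlt
    generalize ∑ i, (-(1 + k i) - h * c i).val = N at hmod hlt
    interval_cases N <;> exact absurd hmod (by decide)
  exact_mod_cast h2

/-- Changing one entry of an index vector changes one summand. -/
lemma sum_add_single {M : Type*} [AddMonoid M] (D : Fin d → M → ℝ) (δ : Fin d → M) (i : Fin d)
    (e : M) (hδ : δ i = 0) :
    ∑ k, D k ((δ + Pi.single i e : Fin d → M) k) = ∑ k, D k (δ k) + (D i e - D i 0) := by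
  rw [← sub_eq_iff_eq_add', ← Finset.sum_sub_distrib, Finset.sum_eq_single i]
  · simp [hδ]
  · intro k _ hk
    simp [hk]
  · simp

/-- The gap at the blocks attached to a codeword `c` shifted by `δ`, in coordinates relative
to `c`. -/
lemma exists_gap_eq {h : ZMod 3} (hh : h ≠ 0) {c : Fin d → ZMod 3} (hc : c ∈ allOnesCode d 3)
    {δ : Fin d → ZMod 3} (hδ : h * ∑ i, δ i = -1) (x : BlockVec d 3) :
    ∃ q : HiLoIndex d, gap q.1 q.2 x =
      ∑ i, ∑ e, ((h * (δ i - e)).val : ℝ) * x i (c i + e) := by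
  have hc' : ∑ i, c i = 0 := hc
  refine ⟨(⟨h, hh⟩, ⟨fun i => -1 - h * (c i + δ i), ?_⟩), ?_⟩
  · have : ∀ i, -1 - h * (c i + δ i) + 1 = -(h * c i) - h * δ i := fun i => by ring
    rw [Finset.sum_congr rfl fun i _ => this i, Finset.sum_sub_distrib, Finset.sum_neg_distrib,
      ← Finset.mul_sum, ← Finset.mul_sum, hδ, hc']
    ring
  · refine Finset.sum_congr rfl fun i _ => ?_
    rw [← Equiv.sum_comp (Equiv.addLeft (c i))]
    refine Finset.sum_congr rfl fun e _ => ?_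
    rw [Equiv.coe_addLeft]
    congr 3
    ring

/-- A functional that is minimal at the codeword `c` among all codewords is minimal there among
all solutions of the system. -/
lemma dot_embed_le_of_minimal (hd : 3 ≤ d) {x : BlockVec d 3} (hx : ∀ i, ∑ j, x i j = 1)
    (hx0 : ∀ i j, 0 ≤ x i j) (hxg : ∀ q : HiLoIndex d, 2 ≤ gap q.1 q.2 x) {w : BlockVec d 3}
    {c : Fin d → ZMod 3} (hc : c ∈ allOnesCode d 3)
    (hmin : ∀ c' ∈ allOnesCode d 3, dot w (embed c) ≤ dot w (embed c')) :
    dot w (embed c) ≤ dot w x := by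
  have hc' : ∑ i, c i = 0 := hc
  have : Nontrivial (Fin d) := Fin.nontrivial_iff_two_le.2 (by omega)
  have hblock : ∀ (f : Fin d → ZMod 3 → ℝ) i, ∑ e, f i (c i + e) = ∑ j, f i j := fun f i =>
    Equiv.sum_comp (Equiv.addLeft (c i)) (f i)
  set u : Fin d → ℝ := fun i => x i (c i + 1) with hu
  set v : Fin d → ℝ := fun i => x i (c i + 2) with hv
  have hx1 : ∀ i, x i (c i + 0) = 1 - u i - v i := by
    intro i
    have := hblock x i
    rw [hx, sum_zmod_three] at this
    linarith
  -- the inequalities, in terms of `u` and `v`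
  set G : ZMod 3 → Fin d → ZMod 3 → ℝ := fun h i δ =>
    ∑ e, ((h * (δ - e)).val : ℝ) * x i (c i + e) with hG
  have hGap : ∀ (h : ZMod 3) (δ : Fin d → ZMod 3), h ≠ 0 → h * ∑ i, δ i = -1 →
      2 ≤ ∑ i, G h i (δ i) := by
    intro h δ hh hδ
    obtain ⟨q, hq⟩ := exists_gap_eq hh hc hδ x
    rw [hG, ← hq]
    exact hxg q
  have hval : ∀ h i δ, G h i δ = ((h * (δ - 0)).val : ℝ) * (1 - u i - v i) +
      ((h * (δ - 1)).val : ℝ) * u i + ((h * (δ - 2)).val : ℝ) * v i := by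
    intro h i δ
    simp only [hG]
    rw [sum_zmod_three, hx1]
  have dec : ∀ (m : ZMod 3) (n : ℕ), m.val = n → (m.val : ℝ) = n := fun m n h => by rw [h]
  have h10 : ∀ i, G 1 i 0 = 2 * u i + v i := fun i => by
    rw [hval, dec _ 0 (by decide), dec _ 2 (by decide), dec _ 1 (by decide)]
    push_cast
    ring
  have h11 : ∀ i, G 1 i 1 = 1 - u i + v i := fun i => by
    rw [hval, dec _ 1 (by decide), dec _ 0 (by decide), dec _ 2 (by decide)]
    push_cast
    ring
  have h12 : ∀ i, G 1 i 2 = 2 - u i - 2 * v i := fun i => by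
    rw [hval, dec _ 2 (by decide), dec _ 1 (by decide), dec _ 0 (by decide)]
    push_cast
    ring
  have h20 : ∀ i, G 2 i 0 = u i + 2 * v i := fun i => by
    rw [hval, dec _ 0 (by decide), dec _ 1 (by decide), dec _ 2 (by decide)]
    push_cast
    ring
  have h21 : ∀ i, G 2 i 1 = 2 - 2 * u i - v i := fun i => by
    rw [hval, dec _ 2 (by decide), dec _ 0 (by decide), dec _ 1 (by decide)]
    push_cast
    ring
  have h22 : ∀ i, G 2 i 2 = 1 + u i - v i := fun i => by
    rw [hval, dec _ 1 (by decide), dec _ 2 (by decide), dec _ 0 (by decide)]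
    push_cast
    ring
  have one : ∀ h e : ZMod 3, h ≠ 0 → h * e = -1 → ∀ i,
      2 ≤ ∑ k, G h k 0 + (G h i e - G h i 0) := by
    intro h e hh he i
    have := hGap h (0 + Pi.single i e) hh (by simpa using he)
    rwa [sum_add_single _ 0 _ _ rfl] at this
  have two : ∀ h e : ZMod 3, h ≠ 0 → h * (e + e) = -1 → ∀ i j, i ≠ j →
      2 ≤ ∑ k, G h k 0 + (G h i e - G h i 0) + (G h j e - G h j 0) := by
    intro h e hh he i j hij
    have := hGap h (0 + Pi.single i e + Pi.single j e) hh
      (by simpa [Finset.sum_add_distrib] using he)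
    rwa [sum_add_single _ _ _ _ (by simp [hij.symm]), sum_add_single _ 0 _ _ rfl] at this
  -- the functional, relative to its value at `c`
  set D : Fin d → ZMod 3 → ℝ := fun i e => w i (c i + e) - w i (c i) with hD
  have hD0 : ∀ i, D i 0 = 0 := fun i => by simp [hD]
  have hcone : ∀ δ : Fin d → ZMod 3, ∑ i, δ i = 0 → 0 ≤ ∑ i, D i (δ i) := by
    intro δ hδ
    have := hmin (c + δ) (by simp [allOnesCode, Finset.sum_add_distrib, hc', hδ])
    rw [dot_embed, dot_embed] at this
    rw [hD, Finset.sum_sub_distrib]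
    exact sub_nonneg.2 this
  have pair : ∀ e e' : ZMod 3, e + e' = 0 → ∀ i j, i ≠ j → 0 ≤ D i e + D j e' := by
    intro e e' he i j hij
    have := hcone (0 + Pi.single i e + Pi.single j e')
      (by simpa [Finset.sum_add_distrib] using he)
    rw [sum_add_single _ _ _ _ (by simp [hij.symm]), sum_add_single _ 0 _ _ rfl] at this
    simpa [hD0] using this
  have triple : ∀ e : ZMod 3, ∀ i j k, i ≠ j → i ≠ k → j ≠ k → 0 ≤ D i e + D j e + D k e := by
    intro e i j k hij hik hjk
    have h3 : ∀ e : ZMod 3, e + e + e = 0 := by decide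
    have := hcone (0 + Pi.single i e + Pi.single j e + Pi.single k e)
      (by simpa [Finset.sum_add_distrib] using h3 e)
    rw [sum_add_single _ _ _ _ (by simp [hik.symm, hjk.symm]),
      sum_add_single _ _ _ _ (by simp [hij.symm]), sum_add_single _ 0 _ _ rfl] at this
    simpa [hD0] using this
  have key : 0 ≤ ∑ i, (D i 1 * u i + D i 2 * v i) := by
    refine sum_nonneg_of_cone (fun i => hx0 _ _) (fun i => hx0 _ _) (fun i => ?_)
      (fun i j hij => ?_) (fun i => ?_) (fun i j hij => ?_)
      (fun i j hij => pair 1 2 (by decide) i j hij) (triple 1) (triple 2)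
    · have := one 1 2 (by decide) (by decide) i
      simp only [h10, h12] at this
      linarith
    · have := two 1 1 (by decide) (by decide) i j hij
      simp only [h10, h11] at this
      linarith
    · have := one 2 1 (by decide) (by decide) i
      simp only [h20, h21] at this
      linarith
    · have := two 2 2 (by decide) (by decide) i j hij
      simp only [h20, h22] at this
      linarith
  have hdot : dot w x = dot w (embed c) + ∑ i, (D i 1 * u i + D i 2 * v i) := by
    rw [dot_embed, ← Finset.sum_add_distrib, dot]
    refine Finset.sum_congr rfl fun i _ => ?_
    rw [← hblock (fun i j => w i j * x i j) i, sum_zmod_three]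
    simp only [add_zero, hD, hu, hv]
    have := hx1 i
    rw [add_zero] at this
    rw [this]
    ring
  linarith

/-- Every linear functional is a scalar product. -/
lemma exists_dot_eq {p : ℕ} [NeZero p] (f : BlockVec d p →ₗ[ℝ] ℝ) : ∃ w, ∀ x, f x = dot w x := by
  refine ⟨fun i j => f (Pi.single i (Pi.single j 1)), fun x => ?_⟩
  rw [← dotHom_apply]
  refine LinearMap.congr_fun (LinearMap.pi_ext' fun i => LinearMap.pi_ext' fun j =>
    LinearMap.ext_ring ?_) x
  simp [dot, Pi.single_apply, ite_apply, Finset.sum_ite_irrel]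

lemma isCutOutBy_codewordPolytope (hd : 3 ≤ d) :
    IsCutOutBy (codewordPolytope d 3) (equation d) (ineq d) := by
  intro x
  constructor
  · intro hx
    have hconv : Convex ℝ {x : BlockVec d 3 | (∀ i, dot (equation d i).1 x = (equation d i).2) ∧
        ∀ q, dot (ineq d q).1 x ≤ (ineq d q).2} :=
      IsCutOutBy.convex (E := equation d) (A := ineq d) fun _ => Iff.rfl
    refine convexHull_min ?_ hconv hx
    rintro _ ⟨c, hc, rfl⟩
    refine holds_iff.2 ⟨sum_embed c, fun i j => ?_, fun q => two_le_gap_embed q.2.2 hc⟩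
    unfold embed
    split_ifs <;> norm_num
  · intro h
    obtain ⟨hx, hx0, hxg⟩ := holds_iff.1 h
    by_contra hnot
    have hfin : (allOnesCode d 3).Finite := Set.toFinite _
    obtain ⟨f, r, hfx, hf⟩ := geometric_hahn_banach_point_closed
      (convex_convexHull ℝ (embed '' allOnesCode d 3)) ((hfin.image embed).isClosed_convexHull ℝ)
      hnot
    obtain ⟨w, hw⟩ := exists_dot_eq (f : BlockVec d 3 →ₗ[ℝ] ℝ)
    obtain ⟨c, hc, hmin⟩ := Set.exists_min_image _ (fun c => dot w (embed c)) hfin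
      ⟨0, by simp [allOnesCode]⟩
    have h1 := dot_embed_le_of_minimal hd hx hx0 hxg hc hmin
    have h2 := hf _ (subset_convexHull ℝ _ ⟨c, hc, rfl⟩)
    have h3 : f x = dot w x := hw x
    have h4 : f (embed c) = dot w (embed c) := hw _
    linarith

/-! ### Points separating the constraints from one another -/

/-- The point all of whose coordinates are `1 / 3`. -/
noncomputable def center (d : ℕ) : BlockVec d 3 := fun _ _ => 1 / 3

lemma sum_center (i : Fin d) : ∑ j, center d i j = 1 := by
  rw [sum_zmod_three]
  norm_num [center]

lemma gap_center {h : ZMod 3} (hh : h ≠ 0) (k : Fin d → ZMod 3) : gap h k (center d) = d := by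
  have : ∀ i, ∑ j, ((-(1 + k i) - h * j).val : ℝ) * center d i j = 1 := by
    intro i
    simp only [center]
    rw [← Finset.sum_mul, sum_val_affine hh]
    norm_num
  simp only [gap, this]
  simp

/-- The center satisfies all inequalities strictly. -/
lemma center_strict (hd : 3 ≤ d) : center d ∈ codewordPolytope d 3 ∧
    ∀ q, dot (ineq d q).1 (center d) < (ineq d q).2 := by
  have hd' : (3 : ℝ) ≤ d := by exact_mod_cast hd
  have hs : ∀ q, dot (ineq d q).1 (center d) < (ineq d q).2 := by
    rintro (ij | q)
    · rw [dot_ineq_inl]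
      norm_num [center, ineq]
    · change dot (hiLoLhs q.1 q.2) (center d) < hiLoRhs q.2.1
      rw [dot_hiLoLhs _ _ sum_center, gap_center q.1.2]
      linarith
  refine ⟨(isCutOutBy_codewordPolytope hd _).2 ⟨fun i => ?_, fun q => (hs q).le⟩, hs⟩
  rw [dot_equation, sum_center]
  rfl

/-- A point violating `x_{i,j} ≥ 0` only: block `i` is `2/3` off position `j` and `-1/3` at `j`. -/
lemma exists_violates_nonneg (hd : 3 ≤ d) (i₀ : Fin d) (j₀ : ZMod 3) :
    ∃ y : BlockVec d 3, (∀ i, ∑ j, y i j = 1) ∧ y i₀ j₀ < 0 ∧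
      (∀ i j, (i, j) ≠ (i₀, j₀) → 0 ≤ y i j) ∧ ∀ q : HiLoIndex d, 2 ≤ gap q.1 q.2 y := by
  have hd' : (3 : ℝ) ≤ d := by exact_mod_cast hd
  refine ⟨fun i j => 1 / 3 + if i = i₀ then 1 / 3 - (if j = j₀ then 1 else 0) else 0,
    fun i => ?_, by norm_num, fun i j hij => ?_, fun q => ?_⟩
  · rw [Finset.sum_add_distrib, Finset.sum_ite_irrel, Finset.sum_sub_distrib]
    simp
  · by_cases hi : i = i₀
    · have hj : j ≠ j₀ := fun hj => hij (by rw [hi, hj])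
      norm_num [hi, hj]
    · norm_num [hi]
  · obtain ⟨⟨h, hh⟩, k, hk⟩ := q
    have hi : ∀ i, ∑ j, ((-(1 + k i) - h * j).val : ℝ) *
        (1 / 3 + if i = i₀ then 1 / 3 - (if j = j₀ then 1 else 0) else 0) =
        1 + if i = i₀ then 1 - ((-(1 + k i) - h * j₀).val : ℝ) else 0 := by
      intro i
      split_ifs with hi
      · simp only [mul_add, mul_sub, Finset.sum_add_distrib, Finset.sum_sub_distrib,
          ← Finset.sum_mul, sum_val_affine hh]
        simp
      · simp only [add_zero, ← Finset.sum_mul, sum_val_affine hh]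
        norm_num
    have hv : ((-(1 + k i₀) - h * j₀).val : ℝ) ≤ 2 := by
      exact_mod_cast Nat.le_of_lt_succ (ZMod.val_lt _)
    change 2 ≤ gap h k _
    rw [gap, Finset.sum_congr rfl fun i _ => hi i, Finset.sum_add_distrib, Finset.sum_ite_eq',
      if_pos (Finset.mem_univ _), Finset.sum_const, Finset.card_univ, Fintype.card_fin,
      nsmul_eq_mul]
    linarith

/-- The block `(1 - t, t, 0)`. -/
def spike (t : ℝ) (r : ZMod 3) : ℝ := if r = 0 then 1 - t else if r = 1 then t else 0

lemma spike_values (t : ℝ) : spike t 0 = 1 - t ∧ spike t 1 = t ∧ spike t 2 = 0 := by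
  refine ⟨by simp [spike], by simp [spike], ?_⟩
  rw [spike, if_neg (by decide), if_neg (by decide)]

lemma sum_spike (t : ℝ) : ∑ r, spike t r = 1 := by
  obtain ⟨h0, h1, h2⟩ := spike_values t
  rw [sum_zmod_three, h0, h1, h2]
  ring

lemma sum_val_mul_spike (t : ℝ) (a : ZMod 3 → ZMod 3) :
    ∑ r, ((a r).val : ℝ) * spike t r = ((a 0).val : ℝ) * (1 - t) + ((a 1).val : ℝ) * t := by
  obtain ⟨h0, h1, h2⟩ := spike_values t
  rw [sum_zmod_three, h0, h1, h2]
  ring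

lemma sum_add_mul_spike_zero (t : ℝ) : ∑ r : ZMod 3, ((r + 0).val : ℝ) * spike t r = t := by
  rw [sum_val_mul_spike, show (0 + 0 : ZMod 3).val = 0 by decide,
    show (1 + 0 : ZMod 3).val = 1 by decide]
  norm_num

lemma le_sum_add_mul_spike {t : ℝ} (ht : t ≤ 1 / 3) (δ : ZMod 3) :
    (t + if δ ≠ 0 then 1 else 0) ≤ ∑ r : ZMod 3, ((r + δ).val : ℝ) * spike t r := by
  have h3 : δ = 0 ∨ δ = 1 ∨ δ = 2 := by revert δ; decide
  rcases h3 with rfl | rfl | rfl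
  · rw [sum_add_mul_spike_zero]
    simp
  · rw [sum_val_mul_spike, show (0 + 1 : ZMod 3).val = 1 by decide,
      show (1 + 1 : ZMod 3).val = 2 by decide, if_pos (by decide)]
    norm_num
    linarith
  · rw [sum_val_mul_spike, show (0 + 2 : ZMod 3).val = 2 by decide,
      show (1 + 2 : ZMod 3).val = 0 by decide, if_pos (by decide)]
    norm_num
    linarith

lemma le_sum_sub_mul_spike {t : ℝ} (ht : t ≤ 1 / 3) (δ : ZMod 3) :
    2 * t ≤ ∑ r : ZMod 3, ((δ - r).val : ℝ) * spike t r := by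
  have h3 : δ = 0 ∨ δ = 1 ∨ δ = 2 := by revert δ; decide
  rcases h3 with rfl | rfl | rfl
  · rw [sum_val_mul_spike, show (0 - 0 : ZMod 3).val = 0 by decide,
      show (0 - 1 : ZMod 3).val = 2 by decide]
    norm_num
  · rw [sum_val_mul_spike, show (1 - 0 : ZMod 3).val = 1 by decide,
      show (1 - 1 : ZMod 3).val = 0 by decide]
    norm_num
    linarith
  · rw [sum_val_mul_spike, show (2 - 0 : ZMod 3).val = 2 by decide,
      show (2 - 1 : ZMod 3).val = 1 by decide]
    norm_num
    linarith

/-- A point violating only the inequality with parameters `q = (h, k)`. Its block `i` puts the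
weight `1 - 1/d` where the weight in `gap h k` is `0`, and `1/d` where that weight is `1`, so that
`gap h k` is `1` there. -/
lemma exists_violates_gap (hd : 3 ≤ d) (q : HiLoIndex d) :
    ∃ y : BlockVec d 3, (∀ i, ∑ j, y i j = 1) ∧ (∀ i j, 0 ≤ y i j) ∧ gap q.1 q.2 y < 2 ∧
      ∀ q' ≠ q, 2 ≤ gap q'.1 q'.2 y := by
  obtain ⟨⟨h, hh⟩, k, hk⟩ := q
  have hd' : (3 : ℝ) ≤ d := by exact_mod_cast hd
  have hd0 : (d : ℝ) ≠ 0 := by linarith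
  set t : ℝ := 1 / d with ht
  have ht0 : 0 ≤ t := by positivity
  have ht3 : t ≤ 1 / 3 := one_div_le_one_div_of_le (by norm_num) hd'
  have hdt : d * t = 1 := by rw [ht]; field_simp
  set y : BlockVec d 3 := fun i j => spike t (-(1 + k i) - h * j) with hy
  -- each block sum, in the variable `r = -(1 + k i) - h * j`
  have hblock : ∀ k' : Fin d → ZMod 3, ∀ i,
      ∑ j, ((-(1 + k' i) - h * j).val : ℝ) * y i j =
        ∑ r : ZMod 3, ((r + (k i - k' i)).val : ℝ) * spike t r := by
    intro k' i
    rw [← sum_comp_affine hh (-(1 + k i)) fun r => ((r + (k i - k' i)).val : ℝ) * spike t r]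
    refine Finset.sum_congr rfl fun j _ => ?_
    rw [hy]
    congr 3
    ring
  have hblock' : ∀ h' : ZMod 3, h' = -h → ∀ k' : Fin d → ZMod 3, ∀ i,
      ∑ j, ((-(1 + k' i) - h' * j).val : ℝ) * y i j =
        ∑ r : ZMod 3, ((-(1 + k i) - (1 + k' i) - r).val : ℝ) * spike t r := by
    rintro _ rfl k' i
    rw [← sum_comp_affine hh (-(1 + k i))
      fun r => ((-(1 + k i) - (1 + k' i) - r).val : ℝ) * spike t r]
    refine Finset.sum_congr rfl fun j _ => ?_
    rw [hy]
    congr 3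
    ring
  refine ⟨y, fun i => ?_, fun i j => ?_, ?_, ?_⟩
  · rw [hy, sum_comp_affine hh _ (spike t), sum_spike]
  · rw [hy]
    simp only [spike]
    split_ifs <;> linarith
  · change gap h k y < 2
    simp only [gap, hblock, sub_self, sum_add_mul_spike_zero]
    simp [hdt]
  · rintro ⟨⟨h', hh'⟩, k', hk'⟩ hne
    change 2 ≤ gap h' k' y
    have hcases : ∀ h h' : ZMod 3, h ≠ 0 → h' ≠ 0 → h' = h ∨ h' = -h := by decide
    rcases hcases h h' hh hh' with rfl | hneg
    · have hkk : k' ≠ k := by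
        rintro rfl
        exact hne rfl
      obtain ⟨i, hi⟩ := Function.ne_iff.1 hkk
      have hone : (1 : ℝ) ≤ ∑ i, if k i - k' i ≠ 0 then (1 : ℝ) else 0 := by
        refine le_trans (le_of_eq ?_) (Finset.single_le_sum
          (f := fun i => if k i - k' i ≠ 0 then (1 : ℝ) else 0)
          (fun i _ => by positivity) (Finset.mem_univ i))
        simp [sub_ne_zero.2 hi.symm]
      have hle := Finset.sum_le_sum fun i (_ : i ∈ Finset.univ) =>
        le_sum_add_mul_spike ht3 (k i - k' i)
      rw [Finset.sum_add_distrib, Finset.sum_const, Finset.card_univ, Fintype.card_fin,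
        nsmul_eq_mul, hdt] at hle
      simp only [gap, hblock]
      linarith
    · have hle := Finset.sum_le_sum fun i (_ : i ∈ Finset.univ) =>
        le_sum_sub_mul_spike ht3 (-(1 + k i) - (1 + k' i))
      rw [Finset.sum_const, Finset.card_univ, Fintype.card_fin, nsmul_eq_mul] at hle
      simp only [gap, hblock' h' hneg]
      linarith

/-- Every inequality is violated by a point that satisfies all other constraints. -/
lemma exists_violates_only (hd : 3 ≤ d) (q : (Fin d × ZMod 3) ⊕ HiLoIndex d) :
    ∃ y, (∀ i, dot (equation d i).1 y = (equation d i).2) ∧ (ineq d q).2 < dot (ineq d q).1 y ∧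
      ∀ q' ≠ q, dot (ineq d q').1 y ≤ (ineq d q').2 := by
  have hgap : ∀ (q : HiLoIndex d) (y : BlockVec d 3), (∀ i, ∑ j, y i j = 1) →
      dot (ineq d (.inr q)).1 y = (ineq d (.inr q)).2 + 2 - gap q.1 q.2 y := fun q y hy =>
    dot_hiLoLhs _ _ hy
  rcases q with ⟨i₀, j₀⟩ | q
  · obtain ⟨y, hy, hneg, hpos, hg⟩ := exists_violates_nonneg hd i₀ j₀
    refine ⟨y, fun i => by rw [dot_equation, hy]; rfl, ?_, ?_⟩
    · rw [dot_ineq_inl]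
      simpa [ineq] using hneg
    · rintro (⟨i, j⟩ | q) hne
      · rw [dot_ineq_inl]
        simpa [ineq] using hpos i j fun h => hne (by rw [h])
      · rw [hgap _ _ hy]
        linarith [hg q]
  · obtain ⟨y, hy, hpos, hlt, hg⟩ := exists_violates_gap hd q
    refine ⟨y, fun i => by rw [dot_equation, hy]; rfl, ?_, ?_⟩
    · rw [hgap _ _ hy]
      linarith
    · rintro (⟨i, j⟩ | q') hne
      · rw [dot_ineq_inl]
        simpa [ineq] using hpos i j
      · rw [hgap _ _ hy]
        linarith [hg q' fun h => hne (by rw [h])]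

/-- Doubling one block of the center violates one equation only. -/
lemma exists_violates_equation (hd : 3 ≤ d) (i₀ : Fin d) :
    ∃ y, dot (equation d i₀).1 y ≠ (equation d i₀).2 ∧
      (∀ i ≠ i₀, dot (equation d i).1 y = (equation d i).2) ∧
      ∀ q, dot (ineq d q).1 y ≤ (ineq d q).2 := by
  have hd' : (3 : ℝ) ≤ d := by exact_mod_cast hd
  set e : BlockVec d 3 := fun i _ => if i = i₀ then 1 / 3 else 0 with he
  have hsum : ∀ i, ∑ j, (center d + e) i j = 1 + if i = i₀ then 1 else 0 := by
    intro i
    simp only [Pi.add_apply]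
    rw [Finset.sum_add_distrib, sum_center, sum_zmod_three]
    simp only [he]
    split_ifs <;> norm_num
  refine ⟨center d + e, ?_, fun i hi => ?_, ?_⟩
  · rw [dot_equation, hsum, if_pos rfl]
    norm_num [equation]
  · rw [dot_equation, hsum, if_neg hi]
    norm_num [equation]
  · rintro (⟨i, j⟩ | ⟨⟨h, hh⟩, k, hk⟩)
    · rw [dot_ineq_inl]
      simp only [ineq, Pi.add_apply, center, he]
      split_ifs <;> norm_num
    · change dot (hiLoLhs h k) (center d + e) ≤ hiLoRhs k
      have hde : dot (hiLoLhs h k) e = 1 - ((k i₀).val : ℝ) := by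
        have hb : ∑ j, hiLoLhs h k i₀ j = 3 - 3 * ((k i₀).val : ℝ) := by
          have := sum_val_affine (neg_ne_zero.2 hh) (k i₀)
          simp only [hiLoLhs, rot, block_zero]
          rw [Finset.sum_sub_distrib]
          simp only [neg_mul, sub_neg_eq_add, add_comm (k i₀)] at this
          rw [this]
          simp
        rw [dot, Finset.sum_eq_single i₀]
        · simp only [he, if_true]
          rw [← Finset.sum_mul, hb]
          ring
        · intro i _ hi
          simp [he, hi]
        · simp
      rw [dot_add, dot_hiLoLhs _ _ sum_center, gap_center hh, hde]
      have : (0 : ℝ) ≤ ((k i₀).val : ℝ) := Nat.cast_nonneg _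
      linarith

/-! ### The ternary system is a minimal representation -/

lemma ineq_injective (hd : 3 ≤ d) : Function.Injective (ineq d) := by
  intro q q' h
  by_contra hne
  obtain ⟨y, -, hlt, hle⟩ := exists_violates_only hd q
  have := hle q' (Ne.symm hne)
  rw [← h] at this
  linarith

lemma equation_injective (hd : 3 ≤ d) : Function.Injective (equation d) := by
  intro i i' h
  by_contra hne
  obtain ⟨y, hy, heq, -⟩ := exists_violates_equation hd i
  have := heq i' (Ne.symm hne)
  rw [← h] at this
  exact hy this

lemma linearIndependent_equation (d : ℕ) :
    LinearIndependent ℝ fun i : Fin d => (equation d i).1 := by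
  rw [Fintype.linearIndependent_iff]
  intro g hg i
  have := congrFun (congrFun hg i) 0
  simpa [equation, Finset.sum_apply] using this

lemma mem_solutionSet_ternarySystem (hd : 1 ≤ d) {x : BlockVec d 3} :
    x ∈ solutionSet (ternarySystem d) ↔
      (∀ i, dot (equation d i).1 x = (equation d i).2) ∧
        ∀ q, dot (ineq d q).1 x ≤ (ineq d q).2 := by
  rw [solutionSet, Set.mem_ofPred_eq, ternarySystem_eq_range hd]
  simp only [Set.mem_union, or_imp, forall_and, Set.forall_mem_range, LinConstraint.Holds]
  exact and_comm

lemma isIrredundant_ternarySystem (hd : 3 ≤ d) : IsIrredundant (ternarySystem d) := by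
  have hd1 : 1 ≤ d := by omega
  intro c hc heq
  have hS := hc
  rw [ternarySystem_eq_range hd1] at hS
  -- it suffices to satisfy all constraints but `c`
  have hkey : ∀ y : BlockVec d 3, (∀ c' ∈ ternarySystem d, c' ≠ c → c'.Holds y) → c.Holds y :=
    fun y hy => (heq ▸ (fun c' hc' => hy c' hc'.1 hc'.2 :
      y ∈ solutionSet (ternarySystem d \ {c})) : y ∈ solutionSet (ternarySystem d)) c hc
  simp only [ternarySystem_eq_range hd1, Set.mem_union, or_imp, forall_and,
    Set.forall_mem_range] at hkey
  rcases hS with ⟨q, rfl⟩ | ⟨i, rfl⟩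
  · obtain ⟨y, hE, hlt, hle⟩ := exists_violates_only hd q
    have : dot (ineq d q).1 y ≤ (ineq d q).2 := hkey y
      ⟨fun q' hq' => hle q' fun h => hq' (by rw [h]), fun i _ => hE i⟩
    linarith
  · obtain ⟨y, hne, hE, hle⟩ := exists_violates_equation hd i
    exact hne (hkey y ⟨fun q _ => hle q, fun i' hi' => hE i' fun h => hi' (by rw [h])⟩)

lemma isMinimalRepresentation_ternarySystem (hd : 3 ≤ d) :
    IsMinimalRepresentation (ternarySystem d) (codewordPolytope d 3) := by
  have hd1 : 1 ≤ d := by omega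
  have hP := isCutOutBy_codewordPolytope hd
  obtain ⟨hz, hzs⟩ := center_strict hd
  refine ⟨?_, ?_, ?_, ?_⟩
  · choose f hf using fun ab : {ab : BlockVec d 3 × ℝ //
      LinConstraint.eq ab.1 ab.2 ∈ ternarySystem d} => (eq_mem_ternarySystem hd1).1 ab.2
    have hinj : Function.Injective f := fun a b h => Subtype.ext (by rw [← hf a, ← hf b, h])
    have := (linearIndependent_equation d).comp f hinj
    convert this using 2 with ab
    rw [Function.comp_apply, hf]
  · rw [affineSpan_of_strict hP hz hzs]
    ext x
    constructor
    · intro hx a b hab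
      obtain ⟨i, hi⟩ := (eq_mem_ternarySystem hd1 (ab := (a, b))).1 hab
      have := hx i
      rwa [hi] at this
    · intro hx i
      exact hx _ _ ((eq_mem_ternarySystem hd1).2 ⟨i, rfl⟩)
  · intro a b hab x hx
    obtain ⟨q, hq⟩ := (le_mem_ternarySystem hd1 (ab := (a, b))).1 hab
    have := ((hP x).1 hx).2 q
    rwa [hq] at this
  · have hset : {ab : BlockVec d 3 × ℝ | LinConstraint.le ab.1 ab.2 ∈ ternarySystem d} =
        Set.range (ineq d) := Set.ext fun ab => le_mem_ternarySystem hd1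
    rw [hset]
    exact bijOn_tightSet_facets hP hz hzs (exists_violates_only hd)

/-- The last block parameter is determined by the others. -/
lemma card_blockIndices (n : ℕ) :
    Nat.card {k : Fin (n + 1) → ZMod 3 // ∑ i, (k i + 1) = 1} = 3 ^ n := by
  have hb : Function.Bijective fun (k : {k : Fin (n + 1) → ZMod 3 // ∑ i, (k i + 1) = 1})
      (i : Fin n) => k.1 i.castSucc := by
    constructor
    · rintro ⟨k, hk⟩ ⟨k', hk'⟩ h
      have hi : ∀ i : Fin n, k i.castSucc = k' i.castSucc := congrFun h
      refine Subtype.ext (funext fun i => Fin.lastCases ?_ hi i)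
      rw [Fin.sum_univ_castSucc, Finset.sum_congr rfl fun i _ => by rw [hi i]] at hk
      rw [Fin.sum_univ_castSucc] at hk'
      linear_combination hk - hk'
    · intro g
      refine ⟨⟨Fin.snoc (α := fun _ => ZMod 3) g (-∑ i, (g i + 1)), ?_⟩, ?_⟩
      · rw [Fin.sum_univ_castSucc]
        simp
      · funext i
        simp
  rw [Nat.card_congr (Equiv.ofBijective _ hb)]
  simp

lemma ncard_ternarySystem (hd : 3 ≤ d) :
    (ternarySystem d).ncard = 2 * 3 ^ (d - 1) + 4 * d := by
  rw [ternarySystem_eq_range (by omega), Set.ncard_union_eq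
    (Set.disjoint_left.2 (by rintro _ ⟨q, rfl⟩ ⟨i, h⟩; cases h))
    (Set.finite_range _) (Set.finite_range _)]
  have h1 : Function.Injective fun q => LinConstraint.le (ineq d q).1 (ineq d q).2 := by
    intro q q' h
    injection h with ha hb
    exact ineq_injective hd (Prod.ext ha hb)
  have h2 : Function.Injective fun i => LinConstraint.eq (equation d i).1 (equation d i).2 := by
    intro q q' h
    injection h with ha hb
    exact equation_injective hd (Prod.ext ha hb)
  rw [← Nat.card_coe_set_eq, ← Nat.card_coe_set_eq, Nat.card_range_of_injective h1,
    Nat.card_range_of_injective h2, Nat.card_sum, Nat.card_prod, Nat.card_prod]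
  have hc : Nat.card {h : ZMod 3 // h ≠ 0} = 2 := by
    rw [Nat.card_eq_fintype_card]
    decide
  obtain ⟨n, rfl⟩ : ∃ n, d = n + 1 := ⟨d - 1, by omega⟩
  rw [hc, card_blockIndices]
  simp
  ring

end SPC

theorem mainTheorem1 (d : ℕ) (hd : 3 ≤ d) :
    SPC.ternarySystem d =
        SPC.hiLo d (fun _ : ZMod 3 => 0) ∪ SPC.phi 2 (SPC.hiLo d (fun _ : ZMod 3 => 0)) ∪
          SPC.simplexConstraints d 3 ∧
      SPC.IsComplete (SPC.ternarySystem d) (SPC.codewordPolytope d 3) ∧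
      SPC.IsIrredundant (SPC.ternarySystem d) ∧
      SPC.IsMinimalRepresentation (SPC.ternarySystem d) (SPC.codewordPolytope d 3) ∧
      (SPC.ternarySystem d).ncard = 2 * 3 ^ (d - 1) + 4 * d := by
  refine ⟨?_, ?_, SPC.isIrredundant_ternarySystem hd,
    SPC.isMinimalRepresentation_ternarySystem hd, SPC.ncard_ternarySystem hd⟩
  · rw [SPC.ternarySystem, SPC.Phi_three, Set.union_comm]
  · ext x
    rw [SPC.isCutOutBy_codewordPolytope hd x, SPC.mem_solutionSet_ternarySystem (by omega)]
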